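/- **Theorem (Exact Risk Identity).** Let $n\ge 1$, $p\ge 0$, $\beta^*\in\mathbb R^p$, and consider the linear model $Y_i=X_i^\top\beta^*+\varepsilon_i$, $i=1,\dots,n$, where $X_1,\dots,X_n$ are iid $N(0,I_p)$ and $(X_1,\dots,X_n)$ is independent of the vector of real random variables $(\varepsilon_1,\dots,\varepsilon_n)$. Let $h:\mathbb R^p\to\mathbb R\cup\{+\infty\}$ be a proper convex function for which the proximal operator $$\mathrm{prox}_h(x)=\operatorname*{argmin}_{b\in\mathbb R^p}\ \tfrac12\|x-b\|^2+h(b)$$ is well defined, that is, the minimum is attained for every $x\in\mathbb R^p$ (for instance $h$ lower semicontinuous). Write $\ell(y,u)=(y-u)^2/2$ for the squared loss, $\ell',\ell''$ for its first and second derivatives in $u$, and $K=n^{-1}\sum_{i=1}^n\mathbb E[\ell''(Y_i,X_i^\top\beta^*)X_iX_i^\top]$. Let $\hat\beta$ and $\eta$ be such that almost surely $$\hat\beta\in\operatorname*{argmin}_{\beta\in\mathbb R^p}\ \frac1n\sum_{i=1}^n\ell(Y_i,X_i^\top\beta)+h(\beta),$$ $$\eta\in\operatorname*{argmin}_{\beta\in\mathbb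 R^p}\ \frac1n\sum_{i=1}^n\ell'(Y_i,X_i^\top\beta^*)X_i^\top(\beta-\beta^*)+\tfrac12(\beta-\beta^*)^\top K(\beta-\beta^*)+h(\beta).$$ Set $\sigma^*=(\frac1n\sum_{i=1}^n\varepsilon_i^2)^{1/2}$. Then for every $t\ge 0$, on an event of probability at least $1-2\exp(-t^2/2)$, $$\Big|\,\|\hat\beta-\beta^*\|-\Big(\mathbb E_Z\big[\|\beta^*-\mathrm{prox}_h(\beta^*+n^{-1/2}\sigma^*Z)\|^2\big]\Big)^{1/2}\Big|\ \le\ \frac{\sigma^*(t+1)}{\sqrt n}+\|\hat\beta-\eta\|,$$ where $\mathbb E_Z$ is the expectation over $Z\sim N(0,I_p)$ with $\sigma^*$ held fixed; this expectation is finite for every value of $\sigma^*$. Moreover, if $\sigma^*>0$ almost surely, then $Z=\frac{1}{\sqrt n\,\sigma^*}\sum_{i=1}^n\varepsilon_iX_i$ has law $N(0,I_p)$ and is independent of $(\varepsilon_1,\dots,\varepsilon_n)$. -/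

import Mathlib

open MeasureTheory ProbabilityTheory

namespace RegularizedRegression

/-- Proper convex extended-real-valued function: it never takes the value `-∞`, is not
identically `+∞`, and its epigraph is convex. -/
structure IsProperConvex {p : ℕ} (h : EuclideanSpace ℝ (Fin p) → EReal) : Prop where
  ne_bot : ∀ b, h b ≠ ⊥
  exists_ne_top : ∃ b, h b ≠ ⊤
  convex_epigraph : Convex ℝ {q : EuclideanSpace ℝ (Fin p) × ℝ | h q.1 ≤ (q.2 : EReal)}

/-- `b` belongs to `argmin f`. -/
def IsArgmin {p : ℕ} (f : EuclideanSpace ℝ (Fin p) → EReal) (b : EuclideanSpace ℝ (Fin p)) :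
    Prop :=
  ∀ b', f b ≤ f b'

/-- The objective `b ↦ ‖x - b‖² / 2 + h b` whose minimizer is the proximal point of `x`. -/
noncomputable def proxObjective {p : ℕ} (h : EuclideanSpace ℝ (Fin p) → EReal)
    (x b : EuclideanSpace ℝ (Fin p)) : EReal :=
  ((‖x - b‖ ^ 2 / 2 : ℝ) : EReal) + h b

/-- The minimum in the definition of the proximal operator is attained at every point. -/
def ProxExists {p : ℕ} (h : EuclideanSpace ℝ (Fin p) → EReal) : Prop :=
  ∀ x, ∃ b, IsArgmin (proxObjective h x) b

open Classical in
/-- The proximal operator `prox_h x = argmin_b ‖x - b‖² / 2 + h b` (and `0` where the minimum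
is not attained). -/
noncomputable def prox {p : ℕ} (h : EuclideanSpace ℝ (Fin p) → EReal)
    (x : EuclideanSpace ℝ (Fin p)) : EuclideanSpace ℝ (Fin p) :=
  if hx : ∃ b, IsArgmin (proxObjective h x) b then hx.choose else 0

/-- The squared loss `ℓ(y, u) = (y - u)² / 2`. -/
noncomputable def squaredLoss (y u : ℝ) : ℝ := (y - u) ^ 2 / 2

/-- The objective `n⁻¹ ∑ᵢ ℓ(yᵢ, xᵢᵀ b) + h b` of the regularized problem. -/
noncomputable def regularizedObjective {n p : ℕ} (ℓ : ℝ → ℝ → ℝ)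
    (h : EuclideanSpace ℝ (Fin p) → EReal) (x : Fin n → EuclideanSpace ℝ (Fin p))
    (y : Fin n → ℝ) (b : EuclideanSpace ℝ (Fin p)) : EReal :=
  (((n : ℝ)⁻¹ * ∑ i, ℓ (y i) (inner ℝ (x i) b) : ℝ) : EReal) + h b

/-- The matrix `K = n⁻¹ ∑ᵢ E[ℓ''(Yᵢ, Xᵢᵀ β) Xᵢ Xᵢᵀ]`, with `ℓ''` the second derivative of `ℓ` in
its second argument. -/
noncomputable def curvatureMatrix {Ω : Type*} [MeasurableSpace Ω] (μ : Measure Ω) {n p : ℕ}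
    (ℓ : ℝ → ℝ → ℝ) (X : Fin n → Ω → EuclideanSpace ℝ (Fin p)) (Y : Fin n → Ω → ℝ)
    (β : EuclideanSpace ℝ (Fin p)) : Matrix (Fin p) (Fin p) ℝ :=
  Matrix.of fun j k => (n : ℝ)⁻¹ * ∑ i, ∫ ω,
    iteratedDeriv 2 (ℓ (Y i ω)) (inner ℝ (X i ω) β) * (X i ω j * X i ω k) ∂μ

/-- The objective defining the first-order expansion:
`n⁻¹ ∑ᵢ ℓ'(yᵢ, xᵢᵀ β) xᵢᵀ (b - β) + (b - β)ᵀ K (b - β) / 2 + h b`, with `ℓ'` the derivative of `ℓ`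
in its second argument. -/
noncomputable def expansionObjective {n p : ℕ} (ℓ : ℝ → ℝ → ℝ) (K : Matrix (Fin p) (Fin p) ℝ)
    (h : EuclideanSpace ℝ (Fin p) → EReal) (x : Fin n → EuclideanSpace ℝ (Fin p))
    (y : Fin n → ℝ) (β b : EuclideanSpace ℝ (Fin p)) : EReal :=
  (((n : ℝ)⁻¹ * ∑ i, deriv (ℓ (y i)) (inner ℝ (x i) β) * inner ℝ (x i) (b - β)
      + ((b - β).ofLp ⬝ᵥ (K.mulVec (b - β).ofLp)) / 2 : ℝ) : EReal) + h b

/-- The noise level `σ* = (n⁻¹ ∑ᵢ eᵢ²)^{1/2}`. -/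
noncomputable def noiseLevel {n : ℕ} (e : Fin n → ℝ) : ℝ :=
  Real.sqrt ((n : ℝ)⁻¹ * ∑ i, e i ^ 2)

/-- The normalized score `(√n σ*)⁻¹ ∑ᵢ eᵢ xᵢ`. -/
noncomputable def normalizedScore {n p : ℕ} (x : Fin n → EuclideanSpace ℝ (Fin p))
    (e : Fin n → ℝ) : EuclideanSpace ℝ (Fin p) :=
  (Real.sqrt n * noiseLevel e)⁻¹ • ∑ i, e i • x i

/-- The squared risk `E ‖β - prox_h (β + n^{-1/2} σ Z)‖²` of the proximal operator in the Gaussian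
sequence model, the expectation being over `Z ∼ N(0, I_p)` with the number `σ` fixed. -/
noncomputable def proxRiskSq {p : ℕ} (n : ℕ) (h : EuclideanSpace ℝ (Fin p) → EReal)
    (β : EuclideanSpace ℝ (Fin p)) (σ : ℝ) : ℝ :=
  ∫ z, ‖β - prox h (β + (σ / Real.sqrt n) • z)‖ ^ 2 ∂(stdGaussian (EuclideanSpace ℝ (Fin p)))

end RegularizedRegression

/-!
For the squared loss `ℓ'' = 1` and the design is isotropic, so `K` is the identity matrix.
Completing the square turns the problem defining `η` into the proximal problem at `β* + w`, with
`w = n⁻¹ ∑ᵢ εᵢ Xᵢ`, so that `η = prox_h (β* + w)` (`isArgmin_proxObjective_of_expansionObjective`,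
`IsArgmin.eq_prox`). Given the noise, `w` has the law of `(σ* / √n) Z` by rotation invariance
(`map_normalizedScore_pi`), and `prox_h` is nonexpansive (`lipschitzWith_prox`). Hence `‖η - β*‖` is
a `σ* / √n`-Lipschitz function of a standard Gaussian vector. Gaussian concentration places it
within `σ* (t + 1) / √n` of its root mean square: `t` comes from the fluctuation around the mean,
and `1` from the difference between the mean and the root mean square, which the variance controls.
Finally `‖β̂ - β*‖` differs from `‖η - β*‖` by at most `‖β̂ - η‖`.

The probabilistic ingredient is the sharp bound `E exp (t (F - E F)) ≤ exp (K² t² / 2)` for a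
`K`-Lipschitz function `F` under the standard Gaussian measure
(`hasSubgaussianMGF_of_lipschitzWith`). It gives the tail bound by Chernoff's method, and
`Var F ≤ K²` by expansion to second order at `t = 0` (`integral_sq_le_of_hasSubgaussianMGF`). Its
proof interpolates between `E[F exp (t F)]` and `E[F] E[exp (t F)]` by
`θ ↦ E[F(X) exp (t F(X cos θ + Y sin θ))]`, for independent standard Gaussian vectors `X` and `Y`.
In the rotated coordinates `U = X cos θ + Y sin θ` and `V = -X sin θ + Y cos θ`, the derivative in
`θ` is the expectation of `F(U cos θ - V sin θ) ⟨∇(exp (t F))(U), V⟩`. With `U` frozen, reflecting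
`V` across the hyperplane orthogonal to the gradient bounds it by `K sin θ` times the norm of the
gradient (`abs_integral_mul_strongDual_le`), with no integration by parts. Since `F` is only
Lipschitz, Rademacher's theorem provides the gradient almost everywhere. The resulting covariance
bound (`integral_mul_sub_le`) is a differential inequality for the moment generating function
(Herbst's argument).
-/

namespace RegularizedRegression

/-! ### The standard Gaussian measure: density, moments, reflections -/

section Gaussian

open Filter Topology
open scoped NNReal ENNReal RealInnerProductSpace

variable {E : Type*} [NormedAddCommGroup E] [InnerProductSpace ℝ E] [FiniteDimensional ℝ E]
  [MeasurableSpace E] [BorelSpace E]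

/-- The characteristic function identifies the standard Gaussian measure with the measure of density
`(2π)^(-d/2) exp (-‖x‖² / 2)`. -/
theorem stdGaussian_absolutelyContinuous : stdGaussian E ≪ (volume : Measure E) := by
  set J : ℝ := (Real.pi / (1 / 2 : ℝ)) ^ (Module.finrank ℝ E / 2 : ℝ) with hJ
  have hJpos : 0 < J := by positivity
  have hint : Integrable (fun x : E => J⁻¹ * Real.exp (-(1 / 2) * ‖x‖ ^ 2)) := by
    refine Integrable.const_mul ?_ _
    by_contra hcon
    have h := GaussianFourier.integral_rexp_neg_mul_sq_norm (V := E) (b := 1 / 2) (by norm_num)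
    rw [integral_undef hcon] at h
    exact hJpos.ne h
  have hfin : IsFiniteMeasure ((volume : Measure E).withDensity
      fun x => ENNReal.ofReal (J⁻¹ * Real.exp (-(1 / 2) * ‖x‖ ^ 2))) :=
    isFiniteMeasure_withDensity_ofReal hint.2
  have key : stdGaussian E = (volume : Measure E).withDensity
      fun x => ENNReal.ofReal (J⁻¹ * Real.exp (-(1 / 2) * ‖x‖ ^ 2)) := by
    refine Measure.ext_of_charFun ?_
    ext t
    rw [charFun_stdGaussian, charFun_apply, integral_withDensity_eq_integral_toReal_smul
      (by fun_prop) (by simp)]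
    have h := GaussianFourier.integral_cexp_neg_mul_sq_norm_add (V := E) (b := (1 / 2 : ℂ))
      (by norm_num) Complex.I t
    have h2 : ∀ x : E, (ENNReal.ofReal (J⁻¹ * Real.exp (-(1 / 2) * ‖x‖ ^ 2))).toReal •
        Complex.exp (⟪x, t⟫ * Complex.I) = ((J⁻¹ : ℝ) : ℂ) *
        Complex.exp (-(1 / 2) * ‖x‖ ^ 2 + Complex.I * ⟪t, x⟫) := by
      intro x
      rw [ENNReal.toReal_ofReal (by positivity), Complex.real_smul, Complex.exp_add,
        real_inner_comm]
      push_cast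
      rw [mul_comm Complex.I]
      ring
    simp_rw [h2]
    rw [integral_const_mul, h]
    have h3 : ((Real.pi : ℂ) / (1 / 2)) ^ (Module.finrank ℝ E / 2 : ℂ) = (J : ℂ) := by
      rw [hJ, Complex.ofReal_cpow (by positivity)]
      norm_num
    rw [h3, ← mul_assoc, ← Complex.ofReal_mul, inv_mul_cancel₀ hJpos.ne']
    simp
    ring_nf
  rw [key]
  exact withDensity_absolutelyContinuous _ _

theorem memLp_norm_stdGaussian {q : ℝ≥0∞} (hq : q ≠ ⊤) :
    MemLp (fun x : E => ‖x‖) q (stdGaussian E) :=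
  (IsGaussian.memLp_id (stdGaussian E) q hq).norm

theorem memLp_stdGaussian_of_lipschitzWith {F : Type*} [NormedAddCommGroup F]
    [MeasurableSpace F] [BorelSpace F] [SecondCountableTopology F]
    {f : E → F} {K : ℝ≥0} (hf : LipschitzWith K f)
    {q : ℝ≥0∞} (hq : q ≠ ⊤) : MemLp f q (stdGaussian E) := by
  have h1 : MemLp (fun x : E => ‖f 0‖ + K * ‖x‖) q (stdGaussian E) :=
    (memLp_const ‖f 0‖).add ((memLp_norm_stdGaussian hq).const_mul (K : ℝ))
  refine h1.mono hf.continuous.aestronglyMeasurable (Eventually.of_forall fun x => ?_)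
  have h2 := hf.dist_le_mul x 0
  rw [dist_eq_norm, dist_zero_right] at h2
  rw [Real.norm_of_nonneg (by positivity)]
  have h3 : ‖f x‖ ≤ ‖f 0‖ + ‖f x - f 0‖ := norm_le_norm_add_norm_sub' _ _
  linarith

theorem integral_sq_strongDual_stdGaussian (l : StrongDual ℝ E) :
    ∫ v, l v ^ 2 ∂(stdGaussian E) = ‖l‖ ^ 2 := by
  rw [← variance_dual_stdGaussian l, variance_eq_integral (by fun_prop)]
  simp

/-- Reflecting `v` across the hyperplane `ker l` preserves the standard Gaussian measure and changes
the sign of `l v`, so that only the increments of `ψ` along the normal direction contribute. -/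
theorem abs_integral_mul_strongDual_le {ψ : E → ℝ} {K : ℝ≥0} (hψ : LipschitzWith K ψ)
    (l : StrongDual ℝ E) : |∫ v, ψ v * l v ∂(stdGaussian E)| ≤ K * ‖l‖ := by
  obtain ⟨a, rfl⟩ := (InnerProductSpace.toDual ℝ E).surjective l
  set l := InnerProductSpace.toDual ℝ E a with hl
  have hla : ∀ v, l v = ⟪a, v⟫ := fun v => by simp [hl]
  have hnorm : ‖l‖ = ‖a‖ := by simp [hl]
  rcases eq_or_ne a 0 with ha | ha
  · simp only [hla, ha, inner_zero_left, mul_zero, integral_zero, abs_zero]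
    positivity
  have hapos : 0 < ‖a‖ := norm_pos_iff.2 ha
  -- `R` maps `a` to `-a` and fixes `ker l`
  set R := (ℝ ∙ a)ᗮ.reflection with hR
  have hRv : ∀ v, R v = v - (2 * ⟪a, v⟫ / ‖a‖ ^ 2) • a := by
    intro v
    rw [hR, Submodule.reflection_orthogonal_apply, Submodule.reflection_singleton_apply]
    simp only [RCLike.ofReal_real_eq_id, id_eq, neg_sub, two_smul, ← add_smul]
    congr 2
    ring
  have hlR : ∀ v, l (R v) = - l v := by
    intro v
    rw [hla, hla, hRv, inner_sub_right, inner_smul_right, real_inner_self_eq_norm_sq]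
    field_simp
    ring
  have hint : Integrable (fun v => ψ v * l v) (stdGaussian E) :=
    MemLp.integrable_mul (p := 2) (q := 2)
      (memLp_stdGaussian_of_lipschitzWith hψ ENNReal.ofNat_ne_top)
      (memLp_stdGaussian_of_lipschitzWith l.lipschitz ENNReal.ofNat_ne_top)
  have hmap := stdGaussian_map R
  have hmp : MeasurePreserving R (stdGaussian E) (stdGaussian E) :=
    ⟨R.continuous.measurable, hmap⟩
  have hemb : MeasurableEmbedding R := R.toHomeomorph.measurableEmbedding
  have h1 : ∫ v, ψ v * l v ∂(stdGaussian E) = - ∫ v, ψ (R v) * l v ∂(stdGaussian E) := by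
    rw [← hmp.integral_comp hemb]
    simp_rw [hlR, mul_neg]
    rw [integral_neg]
  have hint2 : Integrable (fun v => ψ (R v) * l v) (stdGaussian E) := by
    have := (hmp.integrable_comp_emb hemb).2 hint
    refine this.neg.congr (Eventually.of_forall fun v => ?_)
    simp [hlR]
  have h2 : 2 * ∫ v, ψ v * l v ∂(stdGaussian E)
      = ∫ v, (ψ v - ψ (R v)) * l v ∂(stdGaussian E) := by
    simp_rw [sub_mul]
    rw [integral_sub hint hint2, two_mul]
    nth_rewrite 2 [h1]
    ring
  have hsq : Integrable (fun v => l v ^ 2) (stdGaussian E) :=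
    (memLp_stdGaussian_of_lipschitzWith l.lipschitz ENNReal.ofNat_ne_top).integrable_sq
  have h3 : |∫ v, (ψ v - ψ (R v)) * l v ∂(stdGaussian E)|
      ≤ ∫ v, (2 * K / ‖a‖) * l v ^ 2 ∂(stdGaussian E) := by
    rw [← Real.norm_eq_abs]
    refine norm_integral_le_of_norm_le (hsq.const_mul _) (Eventually.of_forall fun v => ?_)
    have h4 := hψ.dist_le_mul v (R v)
    rw [dist_eq_norm, dist_eq_norm, hRv v, sub_sub_cancel, norm_smul, ← hRv v, ← hla v] at h4
    rw [norm_mul]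
    calc ‖ψ v - ψ (R v)‖ * ‖l v‖ ≤ (K * (‖2 * l v / ‖a‖ ^ 2‖ * ‖a‖)) * ‖l v‖ := by gcongr
      _ = 2 * K / ‖a‖ * l v ^ 2 := by
        rw [norm_div, norm_mul, Real.norm_of_nonneg (sq_nonneg ‖a‖), ← sq_abs (l v)]
        simp only [Real.norm_eq_abs, Nat.abs_ofNat]
        field_simp
  rw [integral_const_mul, integral_sq_strongDual_stdGaussian, hnorm, ← h2, abs_mul, abs_two] at h3
  rw [hnorm]
  have h5 : 2 * (K : ℝ) / ‖a‖ * ‖a‖ ^ 2 = 2 * (K * ‖a‖) := by field_simp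
  linarith

end Gaussian

/-! ### Covariance bound by rotation and moment generating functions -/

section GaussianMGF

open Filter Topology
open scoped NNReal ENNReal RealInnerProductSpace

theorem rotation_neg_apply_rotation {V : Type*} [NormedAddCommGroup V] [NormedSpace ℝ V] (θ : ℝ)
    (z : V × V) :
    ContinuousLinearMap.rotation (-θ) (ContinuousLinearMap.rotation θ z) = z := by
  have h := Real.cos_sq_add_sin_sq θ
  ext
  · simp only [ContinuousLinearMap.rotation_apply, Real.cos_neg, Real.sin_neg, smul_add, smul_smul]
    trans (Real.cos θ ^ 2 + Real.sin θ ^ 2) • z.1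
    · module
    · rw [h, one_smul]
  · simp only [ContinuousLinearMap.rotation_apply, Real.cos_neg, Real.sin_neg, smul_add, smul_smul]
    trans (Real.cos θ ^ 2 + Real.sin θ ^ 2) • z.2
    · module
    · rw [h, one_smul]

variable {E : Type*} [NormedAddCommGroup E] [InnerProductSpace ℝ E] [FiniteDimensional ℝ E]
  [MeasurableSpace E] [BorelSpace E]

/-- The interpolated integral `E[f(X) g(X cos θ + Y sin θ)]`, over independent standard Gaussian
vectors `X` and `Y`. -/
noncomputable def rotatedIntegral (f g : E → ℝ) (θ : ℝ) : ℝ :=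
  ∫ z : E × E, f z.1 * g (Real.cos θ • z.1 + Real.sin θ • z.2)
    ∂((stdGaussian E).prod (stdGaussian E))

theorem measurePreserving_rotation_stdGaussian (θ : ℝ) :
    MeasurePreserving (ContinuousLinearMap.rotation (E := E) θ)
      ((stdGaussian E).prod (stdGaussian E)) ((stdGaussian E).prod (stdGaussian E)) :=
  ⟨(ContinuousLinearMap.rotation θ).continuous.measurable,
    IsGaussian.map_rotation_eq_self (by simp) θ⟩

theorem measurable_fderiv_apply_prod (g : E → ℝ) :
    Measurable (fun w : E × E => fderiv ℝ g w.1 w.2) := by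
  borelize (E →L[ℝ] ℝ)
  exact isBoundedBilinearMap_apply.continuous.measurable.comp
    (((measurable_fderiv ℝ g).comp measurable_fst).prodMk measurable_snd)

/-- Differentiation under the integral sign: the integrand is Lipschitz in `θ`, and differentiable
at almost every point because, by Rademacher's theorem, `g` is differentiable almost everywhere for
the law of `X cos θ + Y sin θ`, which is standard Gaussian. -/
theorem hasDerivAt_rotatedIntegral {f g : E → ℝ} {Kf Kg : ℝ≥0} {M : ℝ} (hf : LipschitzWith Kf f)
    (hg : LipschitzWith Kg g) (hM : ∀ x, |f x| ≤ M) (hgM : ∃ M', ∀ x, |g x| ≤ M') (θ : ℝ) :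
    HasDerivAt (rotatedIntegral f g)
      (∫ w : E × E, f (Real.cos θ • w.1 - Real.sin θ • w.2) * fderiv ℝ g w.1 w.2
        ∂((stdGaussian E).prod (stdGaussian E))) θ := by
  obtain ⟨M', hM'⟩ := hgM
  have hM0 : 0 ≤ M := (abs_nonneg _).trans (hM 0)
  have hfc := hf.continuous
  have hgc := hg.continuous
  set G : E × E → ℝ := fun w => f (Real.cos θ • w.1 - Real.sin θ • w.2) * fderiv ℝ g w.1 w.2
    with hG
  have hGm : Measurable G :=
    (Continuous.measurable (by fun_prop)).mul (measurable_fderiv_apply_prod g)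
  have hrot := measurePreserving_rotation_stdGaussian (E := E) θ
  set R := ContinuousLinearMap.rotation (E := E) θ with hR
  -- undoing the rotation expresses the original first coordinate through the rotated pair
  have hG_rot : ∀ z, G (R z) = f z.1 * fderiv ℝ g (R z).1 (R z).2 := by
    intro z
    have h := congrArg Prod.fst (rotation_neg_apply_rotation θ z)
    rw [ContinuousLinearMap.rotation_apply, Real.cos_neg, Real.sin_neg, neg_smul,
      ← sub_eq_add_neg] at h
    simp only [hG, hR]
    simp only at h
    rw [h]
  have hdiff : ∀ᵐ z ∂((stdGaussian E).prod (stdGaussian E)), DifferentiableAt ℝ g (R z).1 := by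
    have h1 : ∀ᵐ x ∂(stdGaussian E), DifferentiableAt ℝ g x :=
      stdGaussian_absolutelyContinuous.ae_le hg.ae_differentiableAt
    exact hrot.quasiMeasurePreserving.ae
      (Measure.quasiMeasurePreserving_fst.ae h1)
  have hmain := hasDerivAt_integral_of_dominated_loc_of_lip
    (μ := (stdGaussian E).prod (stdGaussian E)) (x₀ := θ) (s := Set.univ)
    (F := fun t z => f z.1 * g (Real.cos t • z.1 + Real.sin t • z.2))
    (F' := fun z => G (R z)) (bound := fun z => M * (Kg * (‖z.1‖ + ‖z.2‖)))
    Filter.univ_mem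
    (Eventually.of_forall fun t => Continuous.aestronglyMeasurable (by fun_prop))
    ?_ (hGm.comp hrot.measurable).aestronglyMeasurable ?_ ?_ ?_
  · have h2 := hmain.2
    have h3 : ∫ z, G (R z) ∂((stdGaussian E).prod (stdGaussian E))
        = ∫ w, G w ∂((stdGaussian E).prod (stdGaussian E)) := by
      rw [← integral_map hrot.measurable.aemeasurable hGm.aestronglyMeasurable, hrot.map_eq]
    rw [h3] at h2
    exact h2
  · refine Integrable.of_bound (Continuous.aestronglyMeasurable (by fun_prop)) (M * M')
      (Eventually.of_forall fun z => ?_)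
    rw [norm_mul]
    exact mul_le_mul (hM _) (hM' _) (norm_nonneg _) hM0
  · refine Eventually.of_forall fun z => LipschitzOnWith.of_dist_le_mul fun s _ t _ => ?_
    have hb : 0 ≤ M * (Kg * (‖z.1‖ + ‖z.2‖)) := by positivity
    rw [Real.coe_nnabs, abs_of_nonneg hb, dist_eq_norm, ← mul_sub, norm_mul]
    have h4 : ‖g (Real.cos s • z.1 + Real.sin s • z.2) - g (Real.cos t • z.1 + Real.sin t • z.2)‖
        ≤ Kg * ((‖z.1‖ + ‖z.2‖) * dist s t) := by
      rw [← dist_eq_norm]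
      refine (hg.dist_le_mul _ _).trans ?_
      gcongr
      rw [dist_eq_norm]
      have h5 : Real.cos s • z.1 + Real.sin s • z.2 - (Real.cos t • z.1 + Real.sin t • z.2)
          = (Real.cos s - Real.cos t) • z.1 + (Real.sin s - Real.sin t) • z.2 := by module
      rw [h5]
      refine (norm_add_le _ _).trans ?_
      rw [norm_smul, norm_smul, Real.dist_eq]
      have hc : ‖Real.cos s - Real.cos t‖ ≤ |s - t| := Real.abs_cos_sub_cos_le s t
      have hs : ‖Real.sin s - Real.sin t‖ ≤ |s - t| := Real.abs_sin_sub_sin_le s t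
      nlinarith [norm_nonneg z.1, norm_nonneg z.2]
    calc ‖f z.1‖ * _ ≤ M * (Kg * ((‖z.1‖ + ‖z.2‖) * dist s t)) :=
          mul_le_mul (hM _) h4 (norm_nonneg _) hM0
      _ = _ := by ring
  · have hn : Integrable (fun x : E => ‖x‖) (stdGaussian E) :=
      memLp_one_iff_integrable.1 (memLp_norm_stdGaussian ENNReal.one_ne_top)
    exact (((hn.comp_fst _).add (hn.comp_snd _)).const_mul _).const_mul _
  · filter_upwards [hdiff] with z hz
    rw [hG_rot]
    refine HasDerivAt.const_mul _ ?_
    have hcurve : HasDerivAt (fun t => Real.cos t • z.1 + Real.sin t • z.2) (R z).2 θ := by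
      have := ((Real.hasDerivAt_cos θ).smul_const z.1).add ((Real.hasDerivAt_sin θ).smul_const z.2)
      exact this
    exact HasFDerivAt.comp_hasDerivAt θ (hz.hasFDerivAt) hcurve

/-- The derivative in `θ` is controlled by freezing the first coordinate and applying the
reflection bound to the second one. -/
theorem abs_integral_mul_fderiv_le {f g : E → ℝ} {Kf Kg : ℝ≥0} {M : ℝ} {B : E → ℝ}
    (hf : LipschitzWith Kf f) (hg : LipschitzWith Kg g) (hM : ∀ x, |f x| ≤ M)
    (hB : ∀ x, ‖fderiv ℝ g x‖ ≤ B x) (hBint : Integrable B (stdGaussian E)) {θ : ℝ}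
    (hθ : 0 ≤ Real.sin θ) :
    |∫ w : E × E, f (Real.cos θ • w.1 - Real.sin θ • w.2) * fderiv ℝ g w.1 w.2
        ∂((stdGaussian E).prod (stdGaussian E))|
      ≤ Kf * Real.sin θ * ∫ x, B x ∂(stdGaussian E) := by
  have hM0 : 0 ≤ M := (abs_nonneg _).trans (hM 0)
  have hfc := hf.continuous
  have hn : Integrable (fun x : E => ‖x‖) (stdGaussian E) :=
    memLp_one_iff_integrable.1 (memLp_norm_stdGaussian ENNReal.one_ne_top)
  have hint : Integrable
      (fun w : E × E => f (Real.cos θ • w.1 - Real.sin θ • w.2) * fderiv ℝ g w.1 w.2)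
      ((stdGaussian E).prod (stdGaussian E)) := by
    refine Integrable.mono' (((hn.comp_snd (stdGaussian E)).const_mul (Kg : ℝ)).const_mul M)
      ((Continuous.measurable (by fun_prop)).mul
        (measurable_fderiv_apply_prod g)).aestronglyMeasurable (Eventually.of_forall fun w => ?_)
    rw [norm_mul]
    refine mul_le_mul (hM _) ?_ (norm_nonneg _) hM0
    exact (ContinuousLinearMap.le_opNorm _ _).trans
      (mul_le_mul_of_nonneg_right (norm_fderiv_le_of_lipschitz ℝ hg) (norm_nonneg _))
  rw [integral_prod _ hint, ← integral_const_mul, ← Real.norm_eq_abs]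
  refine norm_integral_le_of_norm_le (hBint.const_mul _) (Eventually.of_forall fun u => ?_)
  have hlip : LipschitzWith (Kf * (Real.sin θ).toNNReal)
      (fun v => f (Real.cos θ • u - Real.sin θ • v)) := by
    refine LipschitzWith.of_dist_le_mul fun v v' => (hf.dist_le_mul _ _).trans (le_of_eq ?_)
    rw [dist_sub_left, dist_smul₀, Real.norm_of_nonneg hθ]
    push_cast
    rw [Real.coe_toNNReal _ hθ]
    ring
  refine (abs_integral_mul_strongDual_le hlip (fderiv ℝ g u)).trans ?_
  push_cast
  rw [Real.coe_toNNReal _ hθ]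
  gcongr
  exact hB u

/-- A covariance bound: the difference between the values of `rotatedIntegral` at `0` and at `π / 2`
is the covariance of `f` and `g`. -/
theorem integral_mul_sub_le {f g : E → ℝ} {Kf Kg : ℝ≥0} {M : ℝ} {B : E → ℝ}
    (hf : LipschitzWith Kf f) (hg : LipschitzWith Kg g) (hM : ∀ x, |f x| ≤ M)
    (hgM : ∃ M', ∀ x, |g x| ≤ M')
    (hB : ∀ x, ‖fderiv ℝ g x‖ ≤ B x) (hBint : Integrable B (stdGaussian E)) :
    ∫ x, f x * g x ∂(stdGaussian E) - (∫ x, f x ∂(stdGaussian E)) * ∫ x, g x ∂(stdGaussian E)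
      ≤ Kf * ∫ x, B x ∂(stdGaussian E) := by
  set C := Kf * ∫ x, B x ∂(stdGaussian E) with hC
  have h0 : rotatedIntegral f g 0 = ∫ x, f x * g x ∂(stdGaussian E) := by
    simp only [rotatedIntegral, Real.cos_zero, Real.sin_zero, one_smul, zero_smul, add_zero]
    rw [integral_fun_fst (fun x => f x * g x)]
    simp
  have h1 : rotatedIntegral f g (Real.pi / 2)
      = (∫ x, f x ∂(stdGaussian E)) * ∫ x, g x ∂(stdGaussian E) := by
    simp only [rotatedIntegral, Real.cos_pi_div_two, Real.sin_pi_div_two, one_smul, zero_smul,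
      zero_add]
    exact integral_prod_mul f g
  have hder := hasDerivAt_rotatedIntegral hf hg hM hgM
  -- `|d/dθ rotatedIntegral f g θ| ≤ C sin θ`, and `C sin θ` is the derivative of `-C cos θ`
  have hmono : MonotoneOn (fun θ => rotatedIntegral f g θ - C * Real.cos θ)
      (Set.Icc 0 (Real.pi / 2)) := by
    have hd : ∀ θ, HasDerivAt (fun θ => rotatedIntegral f g θ - C * Real.cos θ) _ θ :=
      fun θ => (hder θ).sub ((Real.hasDerivAt_cos θ).const_mul C)
    refine monotoneOn_of_deriv_nonneg (convex_Icc _ _)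
      (fun θ _ => (hd θ).continuousAt.continuousWithinAt)
      (fun θ _ => (hd θ).differentiableAt.differentiableWithinAt) fun θ hθ => ?_
    rw [interior_Icc] at hθ
    rw [(hd θ).deriv]
    have hs : 0 ≤ Real.sin θ :=
      Real.sin_nonneg_of_nonneg_of_le_pi hθ.1.le (by linarith [hθ.2, Real.pi_pos])
    have := (abs_le.1 (abs_integral_mul_fderiv_le hf hg hM hB hBint hs)).1
    rw [hC]
    linarith
  have h2 := hmono (Set.left_mem_Icc.2 (by positivity)) (Set.right_mem_Icc.2 (by positivity))
    (by positivity)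
  simp only [h0, h1, Real.cos_zero, Real.cos_pi_div_two] at h2
  linarith

theorem abs_exp_sub_exp_le {a b c : ℝ} (ha : a ≤ c) (hb : b ≤ c) :
    |Real.exp a - Real.exp b| ≤ Real.exp c * |a - b| := by
  have key : ∀ {u v : ℝ}, u ≤ c → v ≤ u →
      |Real.exp u - Real.exp v| ≤ Real.exp c * |u - v| := by
    intro u v hu hvu
    rw [abs_of_nonneg (sub_nonneg.2 (Real.exp_le_exp.2 hvu)), abs_of_nonneg (sub_nonneg.2 hvu)]
    have h1 : Real.exp v = Real.exp u * Real.exp (v - u) := by rw [← Real.exp_add]; ring_nf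
    have h2 := mul_le_mul_of_nonneg_left (Real.add_one_le_exp (v - u)) (Real.exp_pos u).le
    have h3 := mul_le_mul_of_nonneg_right (Real.exp_le_exp.2 hu) (sub_nonneg.2 hvu)
    linarith
  rcases le_total b a with h | h
  · exact key ha h
  · rw [abs_sub_comm, abs_sub_comm a]
    exact key hb h

/-- Herbst's argument: the covariance bound for `F` and `exp (t F)` is a differential inequality
for the moment generating function. -/
theorem mgf_le_of_lipschitzWith_of_bounded {F : E → ℝ} {K : ℝ≥0} {M : ℝ} (hF : LipschitzWith K F)
    (hM : ∀ x, |F x| ≤ M) (hF0 : ∫ x, F x ∂(stdGaussian E) = 0) {t : ℝ} (ht : 0 ≤ t) :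
    mgf F (stdGaussian E) t ≤ Real.exp (K ^ 2 * t ^ 2 / 2) := by
  have hFc := hF.continuous
  have hexp : ∀ s : ℝ, Integrable (fun x => Real.exp (s * F x)) (stdGaussian E) := fun s =>
    integrable_exp_mul_of_mem_Icc hFc.aemeasurable
      (Eventually.of_forall fun x => abs_le.1 (hM x))
  have hset : integrableExpSet F (stdGaussian E) = Set.univ := Set.eq_univ_of_forall hexp
  have hder : ∀ s, HasDerivAt (mgf F (stdGaussian E))
      (∫ x, F x * Real.exp (s * F x) ∂(stdGaussian E)) s :=
    fun s => hasDerivAt_mgf (by simp [hset])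
  have hbd : ∀ s : ℝ, 0 ≤ s → ∫ x, F x * Real.exp (s * F x) ∂(stdGaussian E)
      ≤ K ^ 2 * s * mgf F (stdGaussian E) s := by
    intro s hs
    have hfd : ∀ x, ‖fderiv ℝ (fun x => Real.exp (s * F x)) x‖
        ≤ s * K * Real.exp (s * F x) := by
      intro x
      by_cases hx : DifferentiableAt ℝ F x
      · rw [((hx.hasFDerivAt.const_mul s).exp).fderiv, norm_smul, norm_smul,
          Real.norm_of_nonneg (Real.exp_pos _).le, Real.norm_of_nonneg hs]
        have := norm_fderiv_le_of_lipschitz ℝ (x₀ := x) hF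
        rw [mul_comm]
        gcongr
      · rcases hs.eq_or_lt with rfl | hs
        · simp
        -- `F` is recovered from `exp (s F)` by a logarithm, so the latter is not differentiable
        -- either and its `fderiv` has the default value `0`
        · have hx' : ¬ DifferentiableAt ℝ (fun x => Real.exp (s * F x)) x := by
            intro hcon
            refine hx ?_
            have h1 := (hcon.log (Real.exp_pos _).ne').const_mul s⁻¹
            refine h1.congr_of_eventuallyEq (Eventually.of_forall fun y => ?_)
            simp [Real.log_exp, hs.ne']
          rw [fderiv_zero_of_not_differentiableAt hx', norm_zero]
          positivity
    have hlip : LipschitzWith (s * K * Real.exp (s * M)).toNNReal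
        (fun x => Real.exp (s * F x)) := by
      have hsM : ∀ x, s * F x ≤ s * M := fun x =>
        mul_le_mul_of_nonneg_left (abs_le.1 (hM x)).2 hs
      refine LipschitzWith.of_dist_le_mul fun x y => ?_
      rw [Real.coe_toNNReal _ (by positivity), Real.dist_eq]
      refine (abs_exp_sub_exp_le (hsM x) (hsM y)).trans ?_
      rw [← mul_sub, abs_mul, abs_of_nonneg hs, ← Real.dist_eq]
      have h1 := mul_le_mul_of_nonneg_left (hF.dist_le_mul x y)
        (mul_nonneg (Real.exp_pos (s * M)).le hs)
      linarith
    have h := integral_mul_sub_le hF hlip hM ⟨Real.exp (s * M), fun x => by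
        rw [abs_of_pos (Real.exp_pos _)]
        exact Real.exp_le_exp.2 (mul_le_mul_of_nonneg_left (abs_le.1 (hM x)).2 hs)⟩ hfd
        ((hexp s).const_mul _)
    rw [hF0, zero_mul, sub_zero, integral_const_mul] at h
    rw [mgf]
    linarith
  -- the inequality `φ' ≤ K² s φ` for `φ = mgf F` makes `φ exp (-K² s² / 2)` nonincreasing
  have hanti : AntitoneOn
      (fun s => mgf F (stdGaussian E) s * Real.exp (-(K ^ 2 * s ^ 2 / 2))) (Set.Ici 0) := by
    have hd : ∀ s, HasDerivAt
        (fun s => mgf F (stdGaussian E) s * Real.exp (-(K ^ 2 * s ^ 2 / 2)))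
        ((∫ x, F x * Real.exp (s * F x) ∂(stdGaussian E)) * Real.exp (-(K ^ 2 * s ^ 2 / 2))
          + mgf F (stdGaussian E) s * (Real.exp (-(K ^ 2 * s ^ 2 / 2)) * (-(K ^ 2 * s)))) s := by
      intro s
      refine (hder s).mul (HasDerivAt.exp ?_)
      convert! ((((hasDerivAt_id s).pow 2).const_mul ((K : ℝ) ^ 2)).div_const 2).neg using 1
      simp
      ring
    refine antitoneOn_of_deriv_nonpos (convex_Ici _)
      (fun s _ => (hd s).continuousAt.continuousWithinAt)
      (fun s _ => (hd s).differentiableAt.differentiableWithinAt) fun s hs => ?_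
    rw [interior_Ici] at hs
    rw [(hd s).deriv]
    have h1 := mul_le_mul_of_nonneg_right (hbd s (le_of_lt hs))
      (Real.exp_pos (-(K ^ 2 * s ^ 2 / 2))).le
    linarith
  have h2 := hanti (Set.self_mem_Ici) (Set.mem_Ici.2 ht) ht
  simp only [mgf_zero] at h2
  rw [Real.exp_neg, mul_inv_le_iff₀ (Real.exp_pos _)] at h2
  simpa using h2

end GaussianMGF

/-! ### Gaussian concentration of Lipschitz functions -/

section GaussianConcentration

open Filter Topology
open scoped NNReal ENNReal RealInnerProductSpace

variable {E : Type*} [NormedAddCommGroup E] [InnerProductSpace ℝ E] [FiniteDimensional ℝ E]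
  [MeasurableSpace E] [BorelSpace E]

theorem hasSubgaussianMGF_of_lipschitzWith_of_bounded {F : E → ℝ} {K : ℝ≥0} {M : ℝ}
    (hF : LipschitzWith K F) (hM : ∀ x, |F x| ≤ M) :
    HasSubgaussianMGF (fun x => F x - ∫ y, F y ∂(stdGaussian E)) (K ^ 2) (stdGaussian E) := by
  set m := ∫ y, F y ∂(stdGaussian E) with hm
  set H : E → ℝ := fun x => F x - m with hH
  have hFint : Integrable F (stdGaussian E) :=
    memLp_one_iff_integrable.1 (memLp_stdGaussian_of_lipschitzWith hF ENNReal.one_ne_top)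
  have hHlip : LipschitzWith K H :=
    LipschitzWith.of_dist_le_mul fun x y => by simpa [hH] using hF.dist_le_mul x y
  have hHM : ∀ x, |H x| ≤ M + |m| := fun x =>
    (abs_sub _ _).trans (add_le_add (hM x) le_rfl)
  have hH0 : ∫ x, H x ∂(stdGaussian E) = 0 := by
    rw [hH, integral_sub hFint (integrable_const _), ← hm]
    simp
  refine ⟨fun t => integrable_exp_mul_of_mem_Icc hHlip.continuous.aemeasurable
    (Eventually.of_forall fun x => abs_le.1 (hHM x)), fun t => ?_⟩
  push_cast
  rcases le_total 0 t with ht | ht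
  · exact mgf_le_of_lipschitzWith_of_bounded hHlip hHM hH0 ht
  · have h1 := mgf_le_of_lipschitzWith_of_bounded (F := -H) (t := -t) hHlip.neg
      (M := M + |m|) (fun x => by simpa using hHM x)
      (by simp only [Pi.neg_apply]; rw [integral_neg, hH0, neg_zero]) (by linarith)
    rw [mgf_neg, neg_neg, neg_sq] at h1
    exact h1

/-- Lipschitz functions are approximated by their truncations, and the bound on the moment
generating function passes to the limit by Fatou's lemma. -/
theorem hasSubgaussianMGF_of_lipschitzWith {F : E → ℝ} {K : ℝ≥0} (hF : LipschitzWith K F) :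
    HasSubgaussianMGF (fun x => F x - ∫ y, F y ∂(stdGaussian E)) (K ^ 2) (stdGaussian E) := by
  have hFint : Integrable F (stdGaussian E) :=
    memLp_one_iff_integrable.1 (memLp_stdGaussian_of_lipschitzWith hF ENNReal.one_ne_top)
  have hFc := hF.continuous
  set T : ℕ → E → ℝ := fun N x => max (-(N : ℝ)) (min (N : ℝ) (F x)) with hT
  have hTlip : ∀ N, LipschitzWith K (T N) := fun N => (hF.const_min _).const_max _
  have hTbd : ∀ N x, |T N x| ≤ N := by
    intro N x
    have hN : (0 : ℝ) ≤ N := Nat.cast_nonneg N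
    exact abs_le.2 ⟨le_max_left _ _, max_le (by linarith) (min_le_left _ _)⟩
  have hTle : ∀ N x, |T N x| ≤ |F x| := by
    intro N x
    have hN : (0 : ℝ) ≤ N := Nat.cast_nonneg N
    refine abs_le.2 ⟨?_, ?_⟩
    · rcases min_choice (N : ℝ) (F x) with h | h
      · exact le_max_of_le_right (by rw [h]; linarith [abs_nonneg (F x)])
      · exact le_max_of_le_right (by rw [h]; exact neg_abs_le _)
    · exact max_le (by linarith [abs_nonneg (F x)]) ((min_le_right _ _).trans (le_abs_self _))
  have hTlim : ∀ x, Tendsto (fun N => T N x) atTop (𝓝 (F x)) := by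
    intro x
    refine tendsto_const_nhds.congr' ?_
    filter_upwards [tendsto_natCast_atTop_atTop.eventually_ge_atTop |F x|] with N hN
    rw [hT]
    simp only
    rw [min_eq_right ((le_abs_self _).trans hN), max_eq_right]
    linarith [neg_abs_le (F x)]
  have hmlim : Tendsto (fun N => ∫ y, T N y ∂(stdGaussian E)) atTop
      (𝓝 (∫ y, F y ∂(stdGaussian E))) :=
    tendsto_integral_of_dominated_convergence (fun x => |F x|)
      (fun N => (hTlip N).continuous.aestronglyMeasurable) hFint.abs
      (fun N => Eventually.of_forall (hTle N)) (Eventually.of_forall hTlim)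
  have hsub := fun N => hasSubgaussianMGF_of_lipschitzWith_of_bounded (hTlip N) (hTbd N)
  have hfatou : ∀ t : ℝ, ∫⁻ x, ENNReal.ofReal
      (Real.exp (t * (F x - ∫ y, F y ∂(stdGaussian E)))) ∂(stdGaussian E)
      ≤ ENNReal.ofReal (Real.exp (((K ^ 2 : ℝ≥0) : ℝ) * t ^ 2 / 2)) := by
    intro t
    have h1 : ∀ x, ENNReal.ofReal (Real.exp (t * (F x - ∫ y, F y ∂(stdGaussian E))))
        = liminf (fun N => ENNReal.ofReal
          (Real.exp (t * (T N x - ∫ y, T N y ∂(stdGaussian E))))) atTop := by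
      intro x
      refine (Tendsto.liminf_eq ?_).symm
      exact ENNReal.tendsto_ofReal
        ((Real.continuous_exp.tendsto _).comp (((hTlim x).sub hmlim).const_mul t))
    simp_rw [h1]
    refine (lintegral_liminf_le fun N => ?_).trans ?_
    · have := (hTlip N).continuous
      fun_prop
    · refine liminf_le_of_le (by isBoundedDefault) fun b hb => ?_
      obtain ⟨N, hN⟩ := hb.exists
      refine hN.trans ?_
      rw [← ofReal_integral_eq_lintegral_ofReal ((hsub N).integrable_exp_mul t)
        (Eventually.of_forall fun x => (Real.exp_pos _).le)]
      exact ENNReal.ofReal_le_ofReal ((hsub N).mgf_le t)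
  have hint : ∀ t : ℝ, Integrable
      (fun x => Real.exp (t * (F x - ∫ y, F y ∂(stdGaussian E)))) (stdGaussian E) := by
    intro t
    refine ⟨Continuous.aestronglyMeasurable (by fun_prop), ?_⟩
    rw [hasFiniteIntegral_iff_ofReal (Eventually.of_forall fun x => (Real.exp_pos _).le)]
    exact (hfatou t).trans_lt ENNReal.ofReal_lt_top
  refine ⟨hint, fun t => ?_⟩
  have h2 := hfatou t
  rw [← ofReal_integral_eq_lintegral_ofReal (hint t)
    (Eventually.of_forall fun x => (Real.exp_pos _).le)] at h2
  exact (ENNReal.ofReal_le_ofReal_iff (Real.exp_pos _).le).1 h2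

theorem sq_le_exp_add_exp_neg_sub_two (y : ℝ) : y ^ 2 ≤ Real.exp y + Real.exp (-y) - 2 := by
  have h1 : (y / 2) ^ 2 ≤ Real.sinh (y / 2) ^ 2 := by
    rcases le_total 0 y with h | h
    · exact pow_le_pow_left₀ (by linarith) (Real.self_le_sinh_iff.2 (by linarith)) 2
    · have := Real.sinh_le_self_iff.2 (show y / 2 ≤ 0 by linarith)
      nlinarith
  have h2 : Real.exp (y / 2) * Real.exp (-(y / 2)) = 1 := by rw [← Real.exp_add]; simp
  have h3 : Real.exp y = Real.exp (y / 2) ^ 2 := by rw [← Real.exp_nat_mul]; ring_nf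
  have h4 : Real.exp (-y) = Real.exp (-(y / 2)) ^ 2 := by rw [← Real.exp_nat_mul]; ring_nf
  rw [Real.sinh_eq] at h1
  rw [h3, h4]
  nlinarith

/-- The second-order term at `t = 0` in the bound `E exp (t X) ≤ exp (c t² / 2)`. -/
theorem integral_sq_le_of_hasSubgaussianMGF {Ω : Type*} [MeasurableSpace Ω] {μ : Measure Ω}
    [IsProbabilityMeasure μ] {X : Ω → ℝ} {c : ℝ≥0} (hX : HasSubgaussianMGF X c μ) :
    ∫ ω, X ω ^ 2 ∂μ ≤ c := by
  have hsq : Integrable (fun ω => X ω ^ 2) μ := (hX.memLp 2).integrable_sq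
  have h1 : ∀ t : ℝ, t ^ 2 * ∫ ω, X ω ^ 2 ∂μ ≤ 2 * (Real.exp (c * t ^ 2 / 2) - 1) := by
    intro t
    have hp := hX.integrable_exp_mul t
    have hn := hX.integrable_exp_mul (-t)
    have h2 : ∫ ω, t ^ 2 * X ω ^ 2 ∂μ
        ≤ ∫ ω, (Real.exp (t * X ω) + Real.exp (-t * X ω) - 2) ∂μ := by
      refine integral_mono (hsq.const_mul _) ((hp.add hn).sub (integrable_const _)) fun ω => ?_
      have := sq_le_exp_add_exp_neg_sub_two (t * X ω)
      simp only
      rw [← mul_pow, neg_mul]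
      exact this
    have hpn : Integrable (fun ω => Real.exp (t * X ω) + Real.exp (-t * X ω)) μ := hp.add hn
    rw [integral_const_mul, integral_sub hpn (integrable_const _), integral_add hp hn,
      integral_const, probReal_univ, one_smul] at h2
    have h3 := hX.mgf_le t
    have h4 := hX.mgf_le (-t)
    rw [mgf] at h3 h4
    rw [neg_sq] at h4
    linarith
  have hlim : Tendsto (fun s : ℝ => c + c ^ 2 * s / 2) (𝓝[>] 0) (𝓝 (c : ℝ)) := by
    have : Continuous fun s : ℝ => (c : ℝ) + c ^ 2 * s / 2 := by fun_prop
    simpa using (this.tendsto 0).mono_left nhdsWithin_le_nhds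
  refine ge_of_tendsto hlim ?_
  have hsmall : ∀ᶠ s : ℝ in 𝓝[>] 0, (c : ℝ) * s / 2 < 1 := by
    have hcont : Continuous fun s : ℝ => (c : ℝ) * s / 2 := by fun_prop
    exact ((hcont.tendsto 0).mono_left nhdsWithin_le_nhds).eventually_lt_const (by simp)
  filter_upwards [hsmall, self_mem_nhdsWithin] with s hs hs0
  have hs0 : 0 < s := hs0
  have h2 := h1 (Real.sqrt s)
  rw [Real.sq_sqrt hs0.le] at h2
  have hnn : 0 ≤ (c : ℝ) * s / 2 := by positivity
  have h3 := (abs_le.1 (Real.abs_exp_sub_one_sub_id_le (by rw [abs_of_nonneg hnn]; exact hs.le))).2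
  have h4 : s * ∫ ω, X ω ^ 2 ∂μ ≤ s * (c + c ^ 2 * s / 2) := by nlinarith
  exact le_of_mul_le_mul_left h4 hs0

/-- Gaussian concentration of a nonnegative Lipschitz function around its `L²` norm. The variance
is at most `K²`, so the mean differs from the `L²` norm by at most `K`. -/
theorem measureReal_sqrt_integral_sq_le {F : E → ℝ} {K : ℝ≥0} (hF : LipschitzWith K F)
    (hF0 : ∀ x, 0 ≤ F x) (hK : K ≠ 0) {t : ℝ} (ht : 0 ≤ t) :
    (stdGaussian E).real {x | K * (t + 1) < |F x - √(∫ y, F y ^ 2 ∂(stdGaussian E))|}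
      ≤ 2 * Real.exp (-t ^ 2 / 2) := by
  have hKpos : (0 : ℝ) < K := lt_of_le_of_ne K.2 (by exact_mod_cast hK.symm)
  have hL2 : MemLp F 2 (stdGaussian E) :=
    memLp_stdGaussian_of_lipschitzWith hF ENNReal.ofNat_ne_top
  have hsub := hasSubgaussianMGF_of_lipschitzWith hF
  set m := ∫ y, F y ∂(stdGaussian E) with hm
  set r := √(∫ y, F y ^ 2 ∂(stdGaussian E)) with hr
  have hm0 : 0 ≤ m := integral_nonneg hF0
  have hvar : ∫ x, (F x - m) ^ 2 ∂(stdGaussian E) = r ^ 2 - m ^ 2 := by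
    rw [hr, Real.sq_sqrt (integral_nonneg fun x => sq_nonneg _), hm,
      ← variance_eq_integral hF.continuous.aemeasurable, variance_eq_sub hL2]
    rfl
  -- the sub-Gaussian constant `K²` also bounds the variance, with no loss in the constant
  have hvar_le : r ^ 2 - m ^ 2 ≤ K ^ 2 := by
    rw [← hvar]
    exact_mod_cast integral_sq_le_of_hasSubgaussianMGF hsub
  have hvar_nn : 0 ≤ r ^ 2 - m ^ 2 := by
    rw [← hvar]
    exact integral_nonneg fun x => sq_nonneg _
  have hr0 : 0 ≤ r := Real.sqrt_nonneg _
  have hmr : m ≤ r := abs_le_of_sq_le_sq' (by linarith) hr0 |>.2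
  have hrm : r ≤ m + K := abs_le_of_sq_le_sq' (by nlinarith) (by linarith) |>.2
  have hexp : -((K : ℝ) * t) ^ 2 / (2 * ((K ^ 2 : ℝ≥0) : ℝ)) = -t ^ 2 / 2 := by
    push_cast
    field_simp
  have hup := hsub.measure_ge_le (ε := K * t) (by positivity)
  have hdown := hsub.neg.measure_ge_le (ε := K * t) (by positivity)
  rw [hexp] at hup hdown
  calc _ ≤ (stdGaussian E).real ({x | K * t ≤ F x - m}
        ∪ {x | K * t ≤ (-fun x => F x - m) x}) := by
        refine measureReal_mono fun x hx => ?_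
        simp only [Set.mem_ofPred_eq, lt_abs] at hx
        rcases hx with hx | hx
        · exact Or.inl (by simp only [Set.mem_ofPred_eq]; linarith)
        · exact Or.inr (by simp only [Set.mem_ofPred_eq, Pi.neg_apply]; linarith)
    _ ≤ _ := (measureReal_union_le _ _).trans (by linarith)

end GaussianConcentration

/-! ### The proximal operator -/

section Prox

open scoped NNReal RealInnerProductSpace

variable {p : ℕ} {h : EuclideanSpace ℝ (Fin p) → EReal}

theorem IsProperConvex.exists_real_of_isArgmin (hconv : IsProperConvex h)
    {x b : EuclideanSpace ℝ (Fin p)} (hb : IsArgmin (proxObjective h x) b) :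
    ∃ r : ℝ, h b = r := by
  obtain ⟨b₀, hb₀⟩ := hconv.exists_ne_top
  lift h b₀ to ℝ using ⟨hb₀, hconv.ne_bot b₀⟩ with r₀ hr₀
  have h1 := hb b₀
  have hb_top : h b ≠ ⊤ := by
    intro htop
    simp only [proxObjective] at h1
    rw [htop, ← hr₀, EReal.coe_add_top, ← EReal.coe_add] at h1
    exact absurd h1 (not_le.2 (EReal.coe_lt_top _))
  lift h b to ℝ using ⟨hb_top, hconv.ne_bot b⟩ with r
  exact ⟨r, rfl⟩

/-- The variational inequality satisfied by a proximal point: first-order optimality along the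
segment from `b` to `c`. -/
theorem IsArgmin.inner_sub_sub_le (hconv : IsProperConvex h) {x b c : EuclideanSpace ℝ (Fin p)}
    (hb : IsArgmin (proxObjective h x) b) {rb rc : ℝ} (hrb : h b = rb) (hrc : h c = rc) :
    ⟪x - b, c - b⟫ ≤ rc - rb := by
  have key : ∀ s ∈ Set.Ioo (0 : ℝ) 1, ⟪x - b, c - b⟫ ≤ rc - rb + s * (‖c - b‖ ^ 2 / 2) := by
    intro s hs
    have hmem := hconv.convex_epigraph (x := (b, rb)) (y := (c, rc)) (by simp [hrb])
      (by simp [hrc]) (a := 1 - s) (b := s) (by linarith [hs.2]) hs.1.le (by ring)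
    simp only [Prod.smul_mk, Prod.mk_add_mk, Set.mem_ofPred_eq, smul_eq_mul] at hmem
    have h1 := hb ((1 - s) • b + s • c)
    simp only [proxObjective, hrb] at h1
    have h2 := h1.trans (add_le_add le_rfl hmem)
    rw [← EReal.coe_add, ← EReal.coe_add, EReal.coe_le_coe_iff] at h2
    have h3 : x - ((1 - s) • b + s • c) = (x - b) - s • (c - b) := by module
    rw [h3, norm_sub_sq_real (x - b), inner_smul_right, norm_smul, mul_pow,
      Real.norm_eq_abs, sq_abs] at h2
    have h4 : s * ⟪x - b, c - b⟫ ≤ s * (rc - rb + s * (‖c - b‖ ^ 2 / 2)) := by linarith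
    exact le_of_mul_le_mul_left h4 hs.1
  have hcont : Continuous fun s : ℝ => rc - rb + s * (‖c - b‖ ^ 2 / 2) := by fun_prop
  have hlim := (hcont.tendsto 0).mono_left (nhdsWithin_le_nhds (s := Set.Ioi 0))
  simp only [zero_mul, add_zero] at hlim
  exact ge_of_tendsto hlim (Filter.eventually_of_mem (Ioo_mem_nhdsGT one_pos) key)

/-- Adding the variational inequalities at two proximal points. -/
theorem IsArgmin.norm_sub_le (hconv : IsProperConvex h) {x y b c : EuclideanSpace ℝ (Fin p)}
    (hb : IsArgmin (proxObjective h x) b) (hc : IsArgmin (proxObjective h y) c) :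
    ‖b - c‖ ≤ ‖x - y‖ := by
  obtain ⟨rb, hrb⟩ := hconv.exists_real_of_isArgmin hb
  obtain ⟨rc, hrc⟩ := hconv.exists_real_of_isArgmin hc
  have h1 := hb.inner_sub_sub_le hconv hrb hrc
  have h2 := hc.inner_sub_sub_le hconv hrc hrb
  have h3 : ‖b - c‖ ^ 2 ≤ ⟪x - y, b - c⟫ := by
    rw [← real_inner_self_eq_norm_sq]
    simp only [inner_sub_left, inner_sub_right] at h1 h2 ⊢
    linarith
  have h4 := real_inner_le_norm (x - y) (b - c)
  rcases (norm_nonneg (b - c)).eq_or_lt with h0 | h0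
  · rw [← h0]
    exact norm_nonneg _
  · refine le_of_mul_le_mul_right ?_ h0
    linarith [sq ‖b - c‖]

theorem isArgmin_prox (hprox : ProxExists h) (x : EuclideanSpace ℝ (Fin p)) :
    IsArgmin (proxObjective h x) (prox h x) := by
  rw [prox, dif_pos (hprox x)]
  exact (hprox x).choose_spec

theorem IsArgmin.eq_prox (hconv : IsProperConvex h) (hprox : ProxExists h)
    {x b : EuclideanSpace ℝ (Fin p)} (hb : IsArgmin (proxObjective h x) b) : b = prox h x := by
  have := hb.norm_sub_le hconv (isArgmin_prox hprox x)
  rwa [sub_self, norm_zero, norm_le_zero_iff, sub_eq_zero] at this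

theorem lipschitzWith_prox (hconv : IsProperConvex h) (hprox : ProxExists h) :
    LipschitzWith 1 (prox h) :=
  LipschitzWith.of_dist_le_mul fun x y => by
    simpa [dist_eq_norm] using (isArgmin_prox hprox x).norm_sub_le hconv (isArgmin_prox hprox y)

theorem IsArgmin.of_add_const {f g : EuclideanSpace ℝ (Fin p) → ℝ} {C : ℝ}
    (hfg : ∀ b, g b = f b + C) {b : EuclideanSpace ℝ (Fin p)}
    (hb : IsArgmin (fun b => ((f b : ℝ) : EReal) + h b) b) :
    IsArgmin (fun b => ((g b : ℝ) : EReal) + h b) b := by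
  intro b'
  have h1 := add_le_add (le_refl (C : EReal)) (hb b')
  simp only [← add_assoc, ← EReal.coe_add] at h1
  simp only [hfg, add_comm _ C]
  exact h1

end Prox

/-! ### The first-order expansion for the squared loss -/

section SquaredLoss

open scoped RealInnerProductSpace

theorem deriv_squaredLoss (y u : ℝ) : deriv (squaredLoss y) u = u - y := by
  have h : HasDerivAt (squaredLoss y) (u - y) u := by
    unfold squaredLoss
    convert! (((hasDerivAt_id u).const_sub y).pow 2).div_const 2 using 1
    simp
    ring
  exact h.deriv

theorem iteratedDeriv_two_squaredLoss (y u : ℝ) : iteratedDeriv 2 (squaredLoss y) u = 1 := by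
  rw [iteratedDeriv_succ, iteratedDeriv_one, show deriv (squaredLoss y) = fun u => u - y from
    funext (deriv_squaredLoss y)]
  simp

theorem integral_apply_mul_apply_stdGaussian {p : ℕ} (j k : Fin p) :
    ∫ x, x j * x k ∂(stdGaussian (EuclideanSpace ℝ (Fin p)))
      = (1 : Matrix (Fin p) (Fin p) ℝ) j k := by
  have hcov := covariance_eval_multivariateGaussian (μ := (0 : EuclideanSpace ℝ (Fin p)))
    (Matrix.PosSemidef.one (n := Fin p) (R := ℝ)) j k
  rw [multivariateGaussian_zero_one] at hcov
  have hmem : ∀ i : Fin p, MemLp (fun x : EuclideanSpace ℝ (Fin p) => x i) 2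
      (stdGaussian (EuclideanSpace ℝ (Fin p))) := fun i =>
    memLp_stdGaussian_of_lipschitzWith (EuclideanSpace.proj (𝕜 := ℝ) i).lipschitz
      ENNReal.ofNat_ne_top
  have hmean : ∀ i : Fin p, ∫ x, x i ∂(stdGaussian (EuclideanSpace ℝ (Fin p))) = 0 := fun i =>
    integral_strongDual_stdGaussian (EuclideanSpace.proj (𝕜 := ℝ) i)
  rw [covariance_eq_sub (hmem j) (hmem k), hmean, zero_mul, sub_zero] at hcov
  exact hcov

/-- The curvature matrix is the identity because the design is isotropic and `ℓ'' = 1`. -/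
theorem curvatureMatrix_squaredLoss {Ω : Type*} [MeasurableSpace Ω] {μ : Measure Ω} {n p : ℕ}
    (hn : 0 < n) {X : Fin n → Ω → EuclideanSpace ℝ (Fin p)} (Y : Fin n → Ω → ℝ)
    (hX : ∀ i, HasLaw (X i) (stdGaussian (EuclideanSpace ℝ (Fin p))) μ)
    (β : EuclideanSpace ℝ (Fin p)) :
    curvatureMatrix μ squaredLoss X Y β = 1 := by
  ext j k
  simp only [curvatureMatrix, Matrix.of_apply, iteratedDeriv_two_squaredLoss, one_mul]
  have h1 : ∀ i, ∫ ω, X i ω j * X i ω k ∂μ = (1 : Matrix (Fin p) (Fin p) ℝ) j k := fun i => by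
    rw [← integral_apply_mul_apply_stdGaussian]
    exact (hX i).integral_comp (f := fun x : EuclideanSpace ℝ (Fin p) => x j * x k)
      (Continuous.aestronglyMeasurable (by fun_prop))
  simp only [h1, Finset.sum_const, Finset.card_univ, Fintype.card_fin, nsmul_eq_mul]
  field_simp

/-- Completing the square: for the squared loss and `K = 1`, the expansion objective is the proximal
objective at `β + n⁻¹ ∑ᵢ eᵢ xᵢ`, up to an additive constant. -/
theorem isArgmin_proxObjective_of_expansionObjective {n p : ℕ}
    {h : EuclideanSpace ℝ (Fin p) → EReal} {x : Fin n → EuclideanSpace ℝ (Fin p)} {y e : Fin n → ℝ}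
    {β b : EuclideanSpace ℝ (Fin p)} (hy : ∀ i, y i = ⟪x i, β⟫ + e i)
    (hb : IsArgmin (expansionObjective squaredLoss 1 h x y β) b) :
    IsArgmin (proxObjective h (β + (n : ℝ)⁻¹ • ∑ i, e i • x i)) b := by
  set w := (n : ℝ)⁻¹ • ∑ i, e i • x i with hw
  refine IsArgmin.of_add_const (C := ‖w‖ ^ 2 / 2) (fun c => ?_) hb
  have h1 : (n : ℝ)⁻¹ * ∑ i, deriv (squaredLoss (y i)) ⟪x i, β⟫ * ⟪x i, c - β⟫
      = - ⟪w, c - β⟫ := by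
    rw [hw, real_inner_smul_left, sum_inner, ← mul_neg, ← Finset.sum_neg_distrib]
    congr 1
    refine Finset.sum_congr rfl fun i _ => ?_
    rw [deriv_squaredLoss, hy, real_inner_smul_left]
    ring
  have h2 : (c - β).ofLp ⬝ᵥ (Matrix.mulVec 1 (c - β).ofLp) = ‖c - β‖ ^ 2 := by
    rw [Matrix.one_mulVec, ← real_inner_self_eq_norm_sq, EuclideanSpace.inner_eq_star_dotProduct]
    simp
  rw [h1, h2, show β + w - c = w - (c - β) by abel, norm_sub_sq_real]
  ring

end SquaredLoss

/-! ### The normalized score -/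

section Score

open scoped NNReal ENNReal RealInnerProductSpace

variable {n p : ℕ}

/-- Rotation invariance, in the form of an identity between characteristic functions. -/
theorem map_sum_smul_pi_stdGaussian {ι E : Type*} [Fintype ι] [NormedAddCommGroup E]
    [InnerProductSpace ℝ E] [FiniteDimensional ℝ E] [MeasurableSpace E] [BorelSpace E] {a : ι → ℝ}
    (ha : ∑ i, a i ^ 2 = 1) :
    (Measure.pi fun _ : ι => stdGaussian E).map (fun x => ∑ i, a i • x i) = stdGaussian E := by
  have hm : Measurable fun x : ι → E => ∑ i, a i • x i := by fun_prop
  have : IsProbabilityMeasure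
      ((Measure.pi fun _ : ι => stdGaussian E).map (fun x => ∑ i, a i • x i)) :=
    Measure.isProbabilityMeasure_map hm.aemeasurable
  refine Measure.ext_of_charFun ?_
  ext t
  rw [charFun_apply, integral_map hm.aemeasurable (by fun_prop)]
  have h1 : ∀ x : ι → E, Complex.exp (⟪∑ i, a i • x i, t⟫ * Complex.I)
      = ∏ i, Complex.exp (⟪x i, a i • t⟫ * Complex.I) := by
    intro x
    rw [← Complex.exp_sum, sum_inner, Complex.ofReal_sum, Finset.sum_mul]
    simp only [real_inner_smul_left, real_inner_smul_right]
  simp_rw [h1]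
  rw [integral_fintype_prod_eq_prod (f := fun i x => Complex.exp (⟪x, a i • t⟫ * Complex.I))]
  simp_rw [← charFun_apply, charFun_stdGaussian]
  rw [← Complex.exp_sum]
  congr 1
  simp_rw [norm_smul, Complex.ofReal_mul, mul_pow]
  rw [← Finset.sum_div, Finset.sum_neg_distrib, ← Finset.sum_mul]
  have h2 : ∑ i, ((‖a i‖ : ℝ) : ℂ) ^ 2 = 1 := by
    rw [← Complex.ofReal_one, ← ha]
    push_cast
    refine Finset.sum_congr rfl fun i _ => ?_
    rw [← Complex.ofReal_pow, Real.norm_eq_abs, sq_abs, Complex.ofReal_pow]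
  rw [h2, one_mul]

theorem noiseLevel_sq (e : Fin n → ℝ) : noiseLevel e ^ 2 = (n : ℝ)⁻¹ * ∑ i, e i ^ 2 :=
  Real.sq_sqrt (mul_nonneg (by positivity) (Finset.sum_nonneg fun i _ => sq_nonneg _))

theorem continuous_noiseLevel : Continuous (noiseLevel (n := n)) := by
  unfold noiseLevel
  fun_prop

theorem measurable_normalizedScore :
    Measurable fun q : (Fin n → ℝ) × (Fin n → EuclideanSpace ℝ (Fin p)) =>
      normalizedScore q.2 q.1 := by
  have := (continuous_noiseLevel (n := n)).measurable
  unfold normalizedScore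
  fun_prop

theorem map_normalizedScore_pi (hn : 0 < n) {e : Fin n → ℝ} (he : noiseLevel e ≠ 0) :
    (Measure.pi fun _ : Fin n => stdGaussian (EuclideanSpace ℝ (Fin p))).map
      (fun x => normalizedScore x e) = stdGaussian (EuclideanSpace ℝ (Fin p)) := by
  have hn' : (0 : ℝ) < n := Nat.cast_pos.2 hn
  have h1 : ∑ i, ((√n * noiseLevel e)⁻¹ * e i) ^ 2 = 1 := by
    simp_rw [mul_pow]
    rw [← Finset.mul_sum, inv_pow, mul_pow, Real.sq_sqrt hn'.le, inv_mul_eq_one₀ (by positivity),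
      noiseLevel_sq]
    field_simp
  simp only [normalizedScore, Finset.smul_sum, smul_smul]
  exact map_sum_smul_pi_stdGaussian h1

theorem smul_sum_eq_smul_normalizedScore (x : Fin n → EuclideanSpace ℝ (Fin p)) {e : Fin n → ℝ}
    (he : noiseLevel e ≠ 0) :
    (n : ℝ)⁻¹ • ∑ i, e i • x i = (noiseLevel e / √n) • normalizedScore x e := by
  rw [normalizedScore, smul_smul]
  congr 1
  rcases Nat.eq_zero_or_pos n with rfl | hn
  · simp
  have hn' : (0 : ℝ) < n := Nat.cast_pos.2 hn
  have hs : √(n : ℝ) ≠ 0 := (Real.sqrt_pos.2 hn').ne'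
  nth_rewrite 1 [← Real.sq_sqrt hn'.le]
  field_simp

theorem eq_zero_of_noiseLevel_eq_zero (hn : 0 < n) {e : Fin n → ℝ} (he : noiseLevel e = 0) :
    e = 0 := by
  have hn' : (0 : ℝ) < n := Nat.cast_pos.2 hn
  have h1 := noiseLevel_sq e
  rw [he, zero_pow two_ne_zero, eq_comm, mul_eq_zero_iff_left (by positivity),
    Finset.sum_eq_zero_iff_of_nonneg fun i _ => sq_nonneg _] at h1
  ext i
  simpa using h1 i (Finset.mem_univ i)

end Score

/-! ### Deviations of the proximal loss -/

section Risk

open scoped NNReal ENNReal RealInnerProductSpace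

variable {n p : ℕ} {h : EuclideanSpace ℝ (Fin p) → EReal}

theorem lipschitzWith_norm_sub_prox (hconv : IsProperConvex h) (hprox : ProxExists h)
    (β : EuclideanSpace ℝ (Fin p)) (s : ℝ) :
    LipschitzWith ‖s‖₊ (fun z => ‖β - prox h (β + s • z)‖) := by
  refine LipschitzWith.of_dist_le_mul fun z z' => ?_
  refine (dist_norm_norm_le _ _).trans ?_
  rw [sub_sub_sub_cancel_left, ← dist_eq_norm]
  refine ((lipschitzWith_prox hconv hprox).dist_le_mul _ _).trans ?_
  rw [NNReal.coe_one, one_mul, dist_add_left, dist_smul₀, coe_nnnorm, dist_comm]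

theorem integrable_norm_sub_prox_sq (hconv : IsProperConvex h) (hprox : ProxExists h)
    (β : EuclideanSpace ℝ (Fin p)) (s : ℝ) :
    Integrable (fun z => ‖β - prox h (β + s • z)‖ ^ 2)
      (stdGaussian (EuclideanSpace ℝ (Fin p))) :=
  (memLp_stdGaussian_of_lipschitzWith (lipschitzWith_norm_sub_prox hconv hprox β s)
    ENNReal.ofNat_ne_top).integrable_sq

theorem measurable_proxRiskSq (hconv : IsProperConvex h) (hprox : ProxExists h)
    (β : EuclideanSpace ℝ (Fin p)) : Measurable (proxRiskSq n h β) := by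
  have hc := (lipschitzWith_prox hconv hprox).continuous
  have h1 : Continuous fun q : ℝ × EuclideanSpace ℝ (Fin p) =>
      ‖β - prox h (β + (q.1 / √n) • q.2)‖ ^ 2 := by fun_prop
  exact (h1.stronglyMeasurable.integral_prod_right' (ν := stdGaussian _)).measurable

/-- The pairs of noise vectors and designs for which the loss `‖prox_h (β + w) - β‖` at the
perturbation `w = n⁻¹ ∑ᵢ eᵢ xᵢ` is farther than `σ (t + 1) / √n` from its root mean square. -/
def deviationSet (n : ℕ) (h : EuclideanSpace ℝ (Fin p) → EReal) (β : EuclideanSpace ℝ (Fin p))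
    (t : ℝ) : Set ((Fin n → ℝ) × (Fin n → EuclideanSpace ℝ (Fin p))) :=
  {q | noiseLevel q.1 * (t + 1) / √n <
    |‖β - prox h (β + (n : ℝ)⁻¹ • ∑ i, q.1 i • q.2 i)‖ - √(proxRiskSq n h β (noiseLevel q.1))|}

theorem measurableSet_deviationSet (hconv : IsProperConvex h) (hprox : ProxExists h)
    (β : EuclideanSpace ℝ (Fin p)) (t : ℝ) : MeasurableSet (deviationSet n h β t) := by
  have hc := (lipschitzWith_prox hconv hprox).continuous
  have hσ := continuous_noiseLevel (n := n)
  have hR := measurable_proxRiskSq (n := n) hconv hprox β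
  have h1 : Continuous fun q : (Fin n → ℝ) × (Fin n → EuclideanSpace ℝ (Fin p)) =>
      ‖β - prox h (β + (n : ℝ)⁻¹ • ∑ i, q.1 i • q.2 i)‖ := by fun_prop
  have h2 : Measurable fun q : (Fin n → ℝ) × (Fin n → EuclideanSpace ℝ (Fin p)) =>
      √(proxRiskSq n h β (noiseLevel q.1)) :=
    (hR.comp (hσ.measurable.comp measurable_fst)).sqrt
  have h3 : Measurable fun q : (Fin n → ℝ) × (Fin n → EuclideanSpace ℝ (Fin p)) =>
      noiseLevel q.1 * (t + 1) / √n :=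
    ((hσ.measurable.comp measurable_fst).mul_const _).div_const _
  exact measurableSet_lt h3 (h1.measurable.sub h2).abs

/-- With the noise `e` frozen, `n⁻¹ ∑ᵢ eᵢ xᵢ` is distributed as `(σ / √n) Z`, and Gaussian
concentration applies; if `σ = 0`, then `e = 0` and nothing deviates. -/
theorem measure_deviationSet_slice_le (hn : 0 < n) (hconv : IsProperConvex h)
    (hprox : ProxExists h) (β : EuclideanSpace ℝ (Fin p)) {t : ℝ} (ht : 0 ≤ t) (e : Fin n → ℝ) :
    (Measure.pi fun _ : Fin n => stdGaussian (EuclideanSpace ℝ (Fin p)))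
      (Prod.mk e ⁻¹' deviationSet n h β t) ≤ ENNReal.ofReal (2 * Real.exp (-t ^ 2 / 2)) := by
  by_cases he : noiseLevel e = 0
  · have h1 : Prod.mk e ⁻¹' deviationSet n h β t = ∅ := by
      ext x
      have h2 := eq_zero_of_noiseLevel_eq_zero hn he
      have h3 : √(proxRiskSq n h β 0) = ‖β - prox h β‖ := by
        simp [proxRiskSq]
      simp [deviationSet, he, h3]
      simp [h2]
    rw [h1, measure_empty]
    exact zero_le
  · have hσ : 0 ≤ noiseLevel e := Real.sqrt_nonneg _
    have hσpos : 0 < noiseLevel e / √n :=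
      div_pos (lt_of_le_of_ne hσ (Ne.symm he)) (Real.sqrt_pos.2 (Nat.cast_pos.2 hn))
    set F := fun z : EuclideanSpace ℝ (Fin p) =>
      ‖β - prox h (β + (noiseLevel e / √n) • z)‖ with hF
    have hFlip := lipschitzWith_norm_sub_prox hconv hprox β (noiseLevel e / √n)
    set r := √(∫ y, F y ^ 2 ∂(stdGaussian (EuclideanSpace ℝ (Fin p)))) with hr
    set D : Set (EuclideanSpace ℝ (Fin p)) :=
      {z | (‖noiseLevel e / √n‖₊ : ℝ) * (t + 1) < |F z - r|} with hD
    have hDm : MeasurableSet D := by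
      have hFc : Continuous F := hFlip.continuous
      have hFm : Measurable fun z => |F z - r| := (hFc.sub continuous_const).abs.measurable
      exact measurableSet_lt measurable_const hFm
    have hSm : Measurable fun x : Fin n → EuclideanSpace ℝ (Fin p) => normalizedScore x e := by
      unfold normalizedScore
      fun_prop
    have h1 : Prod.mk e ⁻¹' deviationSet n h β t = (fun x => normalizedScore x e) ⁻¹' D := by
      ext x
      simp only [deviationSet, hD, Set.mem_preimage, Set.mem_ofPred_eq,
        smul_sum_eq_smul_normalizedScore x he, coe_nnnorm, Real.norm_of_nonneg hσpos.le]
      rw [div_mul_eq_mul_div]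
      rfl
    rw [h1, ← Measure.map_apply hSm hDm, map_normalizedScore_pi hn he, ← ofReal_measureReal]
    exact ENNReal.ofReal_le_ofReal (measureReal_sqrt_integral_sq_le hFlip
      (fun z => norm_nonneg _) (nnnorm_ne_zero_iff.2 hσpos.ne') ht)

end Risk

end RegularizedRegression

/-! ### The risk identity -/

open RegularizedRegression

theorem mainTheorem2 {Ω : Type*} [MeasurableSpace Ω] (μ : Measure Ω) [IsProbabilityMeasure μ]
    {n p : ℕ} (hn : 0 < n)
    (h : EuclideanSpace ℝ (Fin p) → EReal)
    (hconv : RegularizedRegression.IsProperConvex h)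
    (hprox : RegularizedRegression.ProxExists h)
    (βstar : EuclideanSpace ℝ (Fin p))
    (X : Fin n → Ω → EuclideanSpace ℝ (Fin p)) (ε Y : Fin n → Ω → ℝ)
    (hX_law : ∀ i, HasLaw (X i) (stdGaussian (EuclideanSpace ℝ (Fin p))) μ)
    (hX_indep : iIndepFun X μ)
    (hε : ∀ i, AEMeasurable (ε i) μ)
    (hXε : IndepFun (fun ω i => X i ω) (fun ω i => ε i ω) μ)
    (hY : ∀ i, ∀ᵐ ω ∂μ, Y i ω = inner ℝ (X i ω) βstar + ε i ω)
    (βhat η : Ω → EuclideanSpace ℝ (Fin p))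
    (hβhat : ∀ᵐ ω ∂μ, RegularizedRegression.IsArgmin
      (RegularizedRegression.regularizedObjective RegularizedRegression.squaredLoss h
        (fun i => X i ω) (fun i => Y i ω)) (βhat ω))
    (hη : ∀ᵐ ω ∂μ, RegularizedRegression.IsArgmin
      (RegularizedRegression.expansionObjective RegularizedRegression.squaredLoss
        (RegularizedRegression.curvatureMatrix μ RegularizedRegression.squaredLoss X Y βstar)
        h (fun i => X i ω) (fun i => Y i ω) βstar) (η ω)) :
    -- the expectation over `Z` is finite for every value of the noise level
    (∀ σ : ℝ, Integrable
      (fun z => ‖βstar - RegularizedRegression.prox h (βstar + (σ / Real.sqrt n) • z)‖ ^ 2)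
      (stdGaussian (EuclideanSpace ℝ (Fin p)))) ∧
    -- `Z = (√n σ*)⁻¹ ∑ᵢ εᵢ Xᵢ` is standard Gaussian, independently of the noise
    ((∀ᵐ ω ∂μ, RegularizedRegression.noiseLevel (fun i => ε i ω) ≠ 0) →
      HasLaw (fun ω => RegularizedRegression.normalizedScore (fun i => X i ω) (fun i => ε i ω))
        (stdGaussian (EuclideanSpace ℝ (Fin p))) μ ∧
      IndepFun (fun ω => RegularizedRegression.normalizedScore (fun i => X i ω) (fun i => ε i ω))
        (fun ω i => ε i ω) μ) ∧
    -- the risk bound, on an event of probability at least `1 - 2 exp (-t² / 2)`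
    ∀ t : ℝ, 0 ≤ t → ∃ A : Set Ω, MeasurableSet A ∧
      1 - 2 * Real.exp (-t ^ 2 / 2) ≤ μ.real A ∧
      ∀ ω ∈ A,
        |‖βhat ω - βstar‖ - Real.sqrt (RegularizedRegression.proxRiskSq n h βstar
            (RegularizedRegression.noiseLevel (fun i => ε i ω)))| ≤
          RegularizedRegression.noiseLevel (fun i => ε i ω) * (t + 1) / Real.sqrt n
            + ‖βhat ω - η ω‖ := by
  have hε' : AEMeasurable (fun ω i => ε i ω) μ := aemeasurable_pi_lambda _ hε
  set ν := μ.map (fun ω i => ε i ω) with hν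
  have hνprob : IsProbabilityMeasure ν := Measure.isProbabilityMeasure_map hε'
  have hεlaw : HasLaw (fun ω i => ε i ω) ν μ := ⟨hε', rfl⟩
  have hXlaw := hX_indep.hasLaw_pi hX_law
  have hjoint := hXε.symm.hasLaw_prod hεlaw hXlaw
  refine ⟨fun σ => integrable_norm_sub_prox_sq hconv hprox βstar _, fun hσ => ?_, fun t ht => ?_⟩
  · have hσν : ∀ᵐ e ∂ν, noiseLevel e ≠ 0 :=
      (ae_map_iff hε' (continuous_noiseLevel.measurable (measurableSet_singleton 0)).compl).2 hσ
    -- almost every section of `(e, x) ↦ (e, score)` sends the design law to the standard Gaussian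
    have hskew := (MeasurePreserving.id ν).skew_product
      (g := fun e x => normalizedScore (p := p) x e)
      measurable_normalizedScore (hσν.mono fun e he => map_normalizedScore_pi hn he)
    have hpair : HasLaw (fun ω => ((fun i => ε i ω),
        normalizedScore (fun i => X i ω) (fun i => ε i ω)))
        (ν.prod (stdGaussian (EuclideanSpace ℝ (Fin p)))) μ := hskew.fun_comp_hasLaw hjoint
    have hscore : HasLaw (fun ω => normalizedScore (fun i => X i ω) (fun i => ε i ω))
        (stdGaussian (EuclideanSpace ℝ (Fin p))) μ :=
      measurePreserving_snd.fun_comp_hasLaw hpair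
    exact ⟨hscore, ((indepFun_iff_hasLaw_prodMk_prod hεlaw hscore).2 hpair).symm⟩
  · set D := deviationSet n h βstar t with hD
    have hDm : MeasurableSet D := measurableSet_deviationSet hconv hprox βstar t
    set good := {ω | ((fun i => ε i ω), fun i => X i ω) ∈ Dᶜ} with hgood
    set opt := {ω | η ω = prox h (βstar + (n : ℝ)⁻¹ • ∑ i, ε i ω • X i ω)} with hopt
    -- on `opt`, the loss of `η` is the proximal loss whose deviations `D` describes
    have hopt_ae : ∀ᵐ ω ∂μ, ω ∈ opt := by
      filter_upwards [hη, ae_all_iff.2 hY] with ω hω hYω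
      rw [curvatureMatrix_squaredLoss hn Y hX_law βstar] at hω
      exact (isArgmin_proxObjective_of_expansionObjective hYω hω).eq_prox hconv hprox
    have hgood_meas : NullMeasurableSet good μ :=
      hjoint.aemeasurable.nullMeasurable hDm.compl
    -- `opt` need not be measurable, but it has full measure, so `good ∩ opt` contains a measurable
    -- set of the same measure as `good`
    have hinter : (good ∩ opt : Set Ω) =ᵐ[μ] good := by
      filter_upwards [hopt_ae] with ω hω
      exact propext ⟨fun hx => hx.1, fun hx => ⟨hx, hω⟩⟩
    obtain ⟨A, hAsub, hAm, hAeq⟩ :=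
      (hgood_meas.congr hinter.symm).exists_measurable_subset_ae_eq
    refine ⟨A, hAm, ?_, fun ω hω => ?_⟩
    · have h1 : μ.real A = 1 - (ν.prod (Measure.pi fun _ : Fin n =>
          stdGaussian (EuclideanSpace ℝ (Fin p)))).real D := by
        rw [← probReal_compl_eq_one_sub hDm, measureReal_congr (hAeq.trans hinter)]
        exact hjoint.measureReal_eq hDm.compl
      have h2 : (ν.prod (Measure.pi fun _ : Fin n =>
          stdGaussian (EuclideanSpace ℝ (Fin p)))) D
          ≤ ENNReal.ofReal (2 * Real.exp (-t ^ 2 / 2)) := by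
        rw [Measure.prod_apply hDm]
        refine (lintegral_mono fun e =>
          measure_deviationSet_slice_le hn hconv hprox βstar ht e).trans ?_
        simp
      have h3 := ENNReal.toReal_le_of_le_ofReal (by positivity) h2
      rw [h1, measureReal_def]
      linarith
    · obtain ⟨hωg, hωo⟩ := hAsub hω
      simp only [hgood, hD, deviationSet, Set.mem_ofPred_eq, Set.mem_compl_iff, not_lt] at hωg
      rw [hopt, Set.mem_ofPred_eq] at hωo
      rw [← hωo, norm_sub_rev] at hωg
      have h4 : |‖βhat ω - βstar‖ - ‖η ω - βstar‖| ≤ ‖βhat ω - η ω‖ := by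
        simpa using abs_norm_sub_norm_le (βhat ω - βstar) (η ω - βstar)
      have h5 := abs_sub_le ‖βhat ω - βstar‖ ‖η ω - βstar‖
        (√(proxRiskSq n h βstar (noiseLevel fun i => ε i ω)))
      linarith
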